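/- Let $A$ be a primitive real $n\times n$ matrix ($n\ge 1$), i.e. $A$ is entrywise nonnegative and some power $A^m$ with $m\ge 1$ is entrywise positive. Let $\rho(A)$ be its spectral radius (Perron root). For a square matrix $M$ let $r_i(M)=\sum_j m_{ij}$ and $\mathbf r(M)=(r_1(M),\dots,r_n(M))$, and for a vector $\mathbf x$ let $D_{\mathbf x}$ be the diagonal matrix with diagonal $\mathbf x$. Define $A^{(0)}=A$ and $$A^{(t)}=D_{\mathbf r^{(t-1)}}^{-1}A^{(t-1)}D_{\mathbf r^{(t-1)}},\qquad \mathbf r^{(t-1)}=\mathbf r(A^{(t-1)}),\qquad t=1,2,\dots$$ Then: 1. The iteration is well defined: $r_i(A^{(t)})>0$ for all $t\ge 0$ and all $i$. 2. The matrices $A^{(t)}$ converge as $t\to\infty$, and every row sum of the limit equals $\rho(A)$. 3. For every $t\ge 0$, $\min_i r_i(A^{(t)})\le\rho(A)\le\max_i r_i(A^{(t)})$; the sequence $\min_i r_i(A^{(t)})$ is nondecreasing in $t$, the sequence $\max_i r_i(A^{(t)})$ is nonincreasing in $t$, and both converge to $\rho(A)$ as $t\to\infty$. 4. With $\mathbf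 1$ the all-ones vector, for every $t\ge 0$ the vector $A^t\mathbf 1$ is entrywise positive, $$A^{(t)}=D_{A^t\mathbf 1}^{-1}\,A\,D_{A^t\mathbf 1},\qquad r_i(A^{(t)})=\frac{(A^{t+1}\mathbf 1)_i}{(A^t\mathbf 1)_i}\quad\text{for all } i,$$ so the iteration is the power method started at $\mathbf 1$. -/

import Mathlib

noncomputable section

namespace MincIteration

variable {ι : Type*} [Fintype ι]

/-- The vector `(r_i(A))_i` of row sums of `A`. -/
def rowSums (A : Matrix ι ι ℝ) : ι → ℝ := fun i => ∑ j, A i j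

/-- The smallest row sum of `A`. -/
def minRowSum [Nonempty ι] (A : Matrix ι ι ℝ) : ℝ :=
  Finset.univ.inf' Finset.univ_nonempty (rowSums A)

/-- The largest row sum of `A`. -/
def maxRowSum [Nonempty ι] (A : Matrix ι ι ℝ) : ℝ :=
  Finset.univ.sup' Finset.univ_nonempty (rowSums A)

variable [DecidableEq ι]

/-- The diagonal similarity `D_x⁻¹ A D_x`. -/
def diagConj (x : ι → ℝ) (A : Matrix ι ι ℝ) : Matrix ι ι ℝ :=
  (Matrix.diagonal x)⁻¹ * A * Matrix.diagonal x

/-- The iteration `A⁽⁰⁾ = A`, `A⁽ᵗ⁺¹⁾ = D_r⁻¹ A⁽ᵗ⁾ D_r`, with `r` the row sums of `A⁽ᵗ⁾`. -/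
def iter (A : Matrix ι ι ℝ) : ℕ → Matrix ι ι ℝ
  | 0 => A
  | t + 1 => diagConj (rowSums (iter A t)) (iter A t)

/-- The spectral radius `ρ(A)`: the largest modulus of a complex eigenvalue of the real
matrix `A`. -/
def rho (A : Matrix ι ι ℝ) : ℝ :=
  (spectralRadius ℂ (A.map (algebraMap ℝ ℂ))).toReal

end MincIteration

end

/-! The conjugations telescope: with `x_t = A^t 1`, the `t`-th iterate is `D_{x_t}⁻¹ A D_{x_t}`, so
its row sums are ratios of consecutive power iterates. Take a Perron pair `A v = l v` with `l, v >
0`; then `l = ρ(A)`. The rescaled vectors `x_t(i) / (l^t v_i)` evolve under the stochastic matrix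
`l⁻¹ D_v⁻¹ A D_v`, which has a positive power, so they tend to a positive constant
(`exists_tendsto_const_of_averaging`). Hence the iterates tend to `D_v⁻¹ A D_v`, whose row sums are
all `l`. Monotonicity of the extreme row sums and their common limit then bound `ρ(A)` for every
`t`. -/

namespace MincIteration

section

open Filter Topology

variable {ι : Type*} [Fintype ι]

/-- A sequence of vectors driven by averagings, some `k`-step averaging being entrywise positive,
converges to a constant vector. -/
theorem exists_tendsto_const_of_averaging [Nonempty ι] {u : ℕ → ι → ℝ} {P Q : Matrix ι ι ℝ} {k : ℕ}
    (hP : ∀ i j, 0 ≤ P i j) (hQ : ∀ i j, 0 < Q i j)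
    (hP1 : ∀ i, ∑ j, P i j = 1) (hQ1 : ∀ i, ∑ j, Q i j = 1)
    (hu : ∀ t i, u (t + 1) i = ∑ j, P i j * u t j)
    (huk : ∀ t i, u (t + k) i = ∑ j, Q i j * u t j) {a : ℝ} (ha : ∀ i, a ≤ u 0 i) :
    ∃ c, a ≤ c ∧ ∀ i, Tendsto (fun t => u t i) atTop (𝓝 c) := by
  let M : ℕ → ℝ := fun t => Finset.univ.sup' Finset.univ_nonempty (u t)
  let m : ℕ → ℝ := fun t => Finset.univ.inf' Finset.univ_nonempty (u t)
  have leM : ∀ t i, u t i ≤ M t := fun t i => Finset.le_sup' (u t) (Finset.mem_univ i)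
  have mle : ∀ t i, m t ≤ u t i := fun t i => Finset.inf'_le (u t) (Finset.mem_univ i)
  have hMle : ∀ t b, (∀ i, u t i ≤ b) → M t ≤ b := fun t b h => Finset.sup'_le _ _ fun i _ => h i
  have hanti : Antitone M := antitone_nat_of_succ_le fun t => hMle _ _ fun i => by
    rw [hu]
    calc ∑ j, P i j * u t j ≤ ∑ j, P i j * M t :=
          Finset.sum_le_sum fun j _ => mul_le_mul_of_nonneg_left (leM t j) (hP i j)
      _ = M t := by rw [← Finset.sum_mul, hP1, one_mul]
  have hau : ∀ t i, a ≤ u t i := by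
    intro t
    induction t with
    | zero => exact ha
    | succ t ih =>
      intro i
      rw [hu]
      calc a = ∑ j, P i j * a := by rw [← Finset.sum_mul, hP1, one_mul]
        _ ≤ _ := Finset.sum_le_sum fun j _ => mul_le_mul_of_nonneg_left (ih j) (hP i j)
  let i₀ : ι := Classical.arbitrary ι
  have hMa : ∀ t, a ≤ M t := fun t => (hau t i₀).trans (leM t i₀)
  obtain ⟨δ, hδ, hδQ⟩ : ∃ δ > 0, ∀ i j, δ ≤ Q i j := by
    obtain ⟨p, hp⟩ := Finite.exists_min fun p : ι × ι => Q p.1 p.2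
    exact ⟨Q p.1 p.2, hQ _ _, fun i j => hp (i, j)⟩
  -- Each `k`-step average gives the minimal coordinate weight at least `δ`, which pulls the maximum
  -- down by that share of the oscillation.
  have hcontr : ∀ t, δ * (M t - m t) ≤ M t - M (t + k) := by
    intro t
    obtain ⟨j₀, -, hj₀⟩ := Finset.exists_mem_eq_inf' Finset.univ_nonempty (u t)
    have : M (t + k) ≤ M t - δ * (M t - m t) := hMle _ _ fun i => by
      have h1 : Q i j₀ * (M t - u t j₀) ≤ ∑ j, Q i j * (M t - u t j) :=
        Finset.single_le_sum (f := fun j => Q i j * (M t - u t j))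
          (fun j _ => mul_nonneg (hQ i j).le (sub_nonneg.2 (leM t j))) (Finset.mem_univ j₀)
      have h2 : ∑ j, Q i j * (M t - u t j) = M t - u (t + k) i := by
        simp_rw [mul_sub, Finset.sum_sub_distrib, ← Finset.sum_mul, hQ1, one_mul, huk]
      have h3 : δ * (M t - u t j₀) ≤ Q i j₀ * (M t - u t j₀) :=
        mul_le_mul_of_nonneg_right (hδQ _ _) (sub_nonneg.2 (leM t j₀))
      have h4 : m t = u t j₀ := hj₀
      rw [h4]
      linarith
    linarith
  have hbdd : BddBelow (Set.range M) := ⟨a, by rintro _ ⟨t, rfl⟩; exact hMa t⟩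
  have hM := tendsto_atTop_ciInf hanti hbdd
  set c := ⨅ t, M t
  refine ⟨c, ge_of_tendsto' hM hMa, fun i => ?_⟩
  -- By `hcontr` this is a lower bound for `m t`; the drop `M t - M (t + k)` vanishes because `M`
  -- converges.
  have hlow : Tendsto (fun t => M t - (M t - M (t + k)) / δ) atTop (𝓝 c) := by
    have := hM.sub ((hM.sub (hM.comp (tendsto_add_atTop_nat k))).div_const δ)
    simpa using this
  refine tendsto_of_tendsto_of_tendsto_of_le_of_le hlow hM (fun t => ?_) (fun t => leM t i)
  have h := (le_div_iff₀' hδ).2 (hcontr t)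
  have := mle t i
  simp only
  linarith

theorem mulVec_pos {B : Matrix ι ι ℝ} (hB : ∀ i j, 0 < B i j) {x : ι → ℝ} (hx : 0 ≤ x)
    (hx0 : x ≠ 0) (i : ι) : 0 < B.mulVec x i := by
  obtain ⟨j, hj⟩ := Function.ne_iff.1 hx0
  exact Finset.sum_pos' (fun j _ => mul_nonneg (hB i j).le (hx j))
    ⟨j, Finset.mem_univ j, mul_pos (hB i j) (lt_of_le_of_ne (hx j) (Ne.symm hj))⟩

theorem mulVec_mono {B : Matrix ι ι ℝ} (hB : ∀ i j, 0 ≤ B i j) {x y : ι → ℝ} (h : x ≤ y) :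
    B.mulVec x ≤ B.mulVec y := fun i =>
  Finset.sum_le_sum fun j _ => mul_le_mul_of_nonneg_left (h j) (hB i j)

variable [DecidableEq ι]

/-! ### Diagonal similarity and the closed form of the iterates -/

theorem diagConj_apply {x : ι → ℝ} (hx : ∀ i, x i ≠ 0) (A : Matrix ι ι ℝ) (i j : ι) :
    diagConj x A i j = A i j * x j / x i := by
  have : (Matrix.diagonal x)⁻¹ = Matrix.diagonal fun i => (x i)⁻¹ := by
    refine Matrix.inv_eq_right_inv ?_
    rw [Matrix.diagonal_mul_diagonal, ← Matrix.diagonal_one]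
    congr 1
    ext i
    exact mul_inv_cancel₀ (hx i)
  rw [diagConj, this, Matrix.mul_diagonal, Matrix.diagonal_mul]
  ring

theorem rowSums_diagConj {x : ι → ℝ} (hx : ∀ i, x i ≠ 0) (A : Matrix ι ι ℝ) (i : ι) :
    rowSums (diagConj x A) i = A.mulVec x i / x i := by
  simp only [rowSums, diagConj_apply hx, ← Finset.sum_div]
  rfl

/-- A zero row of `A` would stay zero in every positive power. -/
theorem exists_row_entry_pos {A : Matrix ι ι ℝ} (hA : A.IsPrimitive) (i : ι) : ∃ j, 0 < A i j := by
  by_contra! h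
  obtain ⟨k, hk, hpos⟩ := hA.exists_pos_pow
  obtain ⟨k, rfl⟩ := Nat.exists_eq_succ_of_ne_zero hk.ne'
  have h0 : ∀ j, A i j = 0 := fun j => le_antisymm (h j) (hA.nonneg i j)
  have := hpos i i
  rw [pow_succ', Matrix.mul_apply] at this
  simp [h0] at this

theorem pow_succ_mulVec (A : Matrix ι ι ℝ) (t : ℕ) (x : ι → ℝ) :
    (A ^ (t + 1)).mulVec x = A.mulVec ((A ^ t).mulVec x) := by
  rw [Matrix.mulVec_mulVec, pow_succ']

theorem pow_mulVec_one_pos {A : Matrix ι ι ℝ} (hA : A.IsPrimitive) (t : ℕ) (i : ι) :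
    0 < (A ^ t).mulVec 1 i := by
  induction t generalizing i with
  | zero => simp
  | succ t ih =>
    obtain ⟨j, hj⟩ := exists_row_entry_pos hA i
    rw [pow_succ_mulVec]
    exact Finset.sum_pos' (fun j _ => mul_nonneg (hA.nonneg i j) (ih j).le)
      ⟨j, Finset.mem_univ j, mul_pos hj (ih j)⟩

theorem iter_eq_diagConj {A : Matrix ι ι ℝ} (hA : A.IsPrimitive) (t : ℕ) :
    iter A t = diagConj ((A ^ t).mulVec 1) A := by
  induction t with
  | zero =>
    ext i j
    rw [diagConj_apply (fun i => (pow_mulVec_one_pos hA 0 i).ne')]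
    simp [iter]
  | succ t ih =>
    have h0 := fun i => (pow_mulVec_one_pos hA t i).ne'
    have h1 := fun i => (pow_mulVec_one_pos hA (t + 1) i).ne'
    have hr : ∀ i, rowSums (iter A t) i = (A ^ (t + 1)).mulVec 1 i / (A ^ t).mulVec 1 i :=
      fun i => by rw [ih, rowSums_diagConj h0, pow_succ_mulVec]
    ext i j
    rw [diagConj_apply h1, iter, diagConj_apply fun i => by rw [hr]; exact div_ne_zero (h1 i) (h0 i),
      hr, hr, ih, diagConj_apply h0]
    have := h0 i
    have := h0 j
    have := h1 i
    field_simp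

theorem rowSums_iter {A : Matrix ι ι ℝ} (hA : A.IsPrimitive) (t : ℕ) (i : ι) :
    rowSums (iter A t) i = (A ^ (t + 1)).mulVec 1 i / (A ^ t).mulVec 1 i := by
  rw [iter_eq_diagConj hA, rowSums_diagConj fun i => (pow_mulVec_one_pos hA t i).ne',
    pow_succ_mulVec]

/-! ### Perron eigenpair and spectral radius -/

theorem pow_mulVec_eigenvector {A : Matrix ι ι ℝ} {v : ι → ℝ} {l : ℝ} (h : A.mulVec v = l • v)
    (k : ℕ) : (A ^ k).mulVec v = l ^ k • v := by
  induction k with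
  | zero => simp
  | succ k ih => rw [pow_succ_mulVec, ih, Matrix.mulVec_smul, h, smul_smul, pow_succ]

/-- A subinvariant nonnegative vector with the largest possible factor is an eigenvector. -/
theorem exists_pos_eigenvector [Nonempty ι] {A : Matrix ι ι ℝ} (hA : A.IsPrimitive) :
    ∃ (l : ℝ) (v : ι → ℝ), 0 < l ∧ (∀ i, 0 < v i) ∧ A.mulVec v = l • v := by
  obtain ⟨k, hk, hpos⟩ := hA.exists_pos_pow
  let b : ℝ := ∑ i, ∑ j, A i j
  have hbound : ∀ (l : ℝ) (x : ι → ℝ), x ∈ stdSimplex ℝ ι → l • x ≤ A.mulVec x → l ≤ b := by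
    intro l x hx h
    calc l = ∑ i, (l • x) i := by simp [← Finset.mul_sum, hx.2]
      _ ≤ ∑ i, A.mulVec x i := Finset.sum_le_sum fun i _ => h i
      _ ≤ b := Finset.sum_le_sum fun i _ => Finset.sum_le_sum fun j _ => by
        have : x j ≤ 1 := hx.2 ▸ Finset.single_le_sum (fun j _ => hx.1 j) (Finset.mem_univ j)
        exact mul_le_of_le_one_right (hA.nonneg i j) this
  let S : Set (ℝ × (ι → ℝ)) :=
    (Set.Icc 0 b ×ˢ stdSimplex ℝ ι) ∩ {p | p.1 • p.2 ≤ A.mulVec p.2}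
  have hmv : Continuous fun p : ℝ × (ι → ℝ) => A.mulVec p.2 :=
    Continuous.matrix_mulVec continuous_const continuous_snd
  have hS : IsCompact S := (isCompact_Icc.prod (isCompact_stdSimplex ℝ ι)).inter_right
    (isClosed_le (continuous_fst.smul continuous_snd) hmv)
  have hne : S.Nonempty := by
    let x : ι → ℝ := Pi.single (Classical.arbitrary ι) 1
    have hx : x ∈ stdSimplex ℝ ι := single_mem_stdSimplex ℝ _
    have h0 : (0 : ℝ) • x ≤ A.mulVec x := by
      rw [zero_smul]
      exact fun i => Finset.sum_nonneg fun j _ => mul_nonneg (hA.nonneg i j) (hx.1 j)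
    exact ⟨(0, x), ⟨⟨le_rfl, hbound 0 x hx h0⟩, hx⟩, h0⟩
  obtain ⟨⟨l, x⟩, ⟨⟨hl, hx⟩, hlx⟩, hmax⟩ := hS.exists_isMaxOn hne continuous_fst.continuousOn
  have hx0 : x ≠ 0 := by
    rintro rfl
    simpa using hx.2
  have hxnn : 0 ≤ x := fun i => hx.1 i
  have heig : A.mulVec x = l • x := by
    by_contra hneq
    -- `A ^ k` turns the nonzero defect `A x - l x ≥ 0` into a strictly positive one, so `y`, once
    -- normalized, admits a factor larger than `l`.
    let y := (A ^ k).mulVec x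
    have hy : ∀ i, 0 < y i := mulVec_pos hpos hxnn hx0
    have hAy : ∀ i, l * y i < A.mulVec y i := by
      intro i
      have h := mulVec_pos hpos (sub_nonneg.2 hlx) (sub_ne_zero.2 hneq) i
      have hcomm : (A ^ k).mulVec (A.mulVec x) = A.mulVec y := by
        rw [Matrix.mulVec_mulVec, ← pow_succ, pow_succ_mulVec]
      rw [Matrix.mulVec_sub, Matrix.mulVec_smul, hcomm] at h
      exact sub_pos.1 h
    obtain ⟨i₁, hi₁⟩ := Finite.exists_min fun i => A.mulVec y i / y i
    let l' := A.mulVec y i₁ / y i₁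
    have hll' : l < l' := (lt_div_iff₀ (hy i₁)).2 (hAy i₁)
    let s := ∑ i, y i
    have hs : 0 < s := Finset.sum_pos (fun i _ => hy i) Finset.univ_nonempty
    have hz : s⁻¹ • y ∈ stdSimplex ℝ ι :=
      ⟨fun i => mul_nonneg (inv_nonneg.2 hs.le) (hy i).le, by
        simp only [Pi.smul_apply, smul_eq_mul, ← Finset.mul_sum]
        exact inv_mul_cancel₀ hs.ne'⟩
    have hl'z : l' • s⁻¹ • y ≤ A.mulVec (s⁻¹ • y) := by
      rw [Matrix.mulVec_smul, smul_comm]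
      exact fun i => mul_le_mul_of_nonneg_left ((le_div_iff₀ (hy i)).1 (hi₁ i)) (inv_nonneg.2 hs.le)
    have : l' ≤ l := hmax (a := (l', s⁻¹ • y))
      ⟨⟨⟨hl.1.trans hll'.le, hbound _ _ hz hl'z⟩, hz⟩, hl'z⟩
    linarith
  have hkx : ∀ i, 0 < l ^ k * x i := fun i => by
    have := mulVec_pos hpos hxnn hx0 i
    rwa [pow_mulVec_eigenvector heig] at this
  have hl0 : l ≠ 0 := by
    rintro rfl
    simpa [hk.ne'] using hkx (Classical.arbitrary ι)
  have hlpos : 0 < l := lt_of_le_of_ne hl.1 hl0.symm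
  exact ⟨l, x, hlpos, fun i => (mul_pos_iff_of_pos_left (pow_pos hlpos k)).1 (hkx i), heig⟩

theorem norm_le_of_mem_spectrum {A : Matrix ι ι ℝ} (hA : ∀ i j, 0 ≤ A i j) {l : ℝ} {v : ι → ℝ}
    (hv : ∀ i, 0 < v i) (h : A.mulVec v = l • v) {μ : ℂ}
    (hμ : μ ∈ spectrum ℂ (A.map (algebraMap ℝ ℂ))) : ‖μ‖ ≤ l := by
  rw [← Matrix.spectrum_toLin', ← Module.End.hasEigenvalue_iff_mem_spectrum] at hμ
  obtain ⟨z, hz⟩ := hμ.exists_hasEigenvector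
  obtain ⟨i₁, hi₁⟩ := Function.ne_iff.1 hz.2
  have : Nonempty ι := ⟨i₁⟩
  -- Compare `|z|` with `v` at the coordinate where the ratio is largest; there the triangle
  -- inequality gives the bound.
  obtain ⟨i, hi⟩ := Finite.exists_max fun i => ‖z i‖ / v i
  have hzi : 0 < ‖z i‖ := by
    have := (div_pos (norm_pos_iff.2 hi₁) (hv i₁)).trans_le (hi i₁)
    exact (div_pos_iff_of_pos_right (hv i)).1 this
  have he : ∑ j, (A i j : ℂ) * z j = μ * z i := congrFun hz.apply_eq_smul i
  have hvi : ∑ j, A i j * v j = l * v i := congrFun h i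
  have hle : ‖μ‖ * ‖z i‖ ≤ l * ‖z i‖ := by
    calc ‖μ‖ * ‖z i‖ = ‖∑ j, (A i j : ℂ) * z j‖ := by rw [he, norm_mul]
      _ ≤ ∑ j, A i j * ‖z j‖ := (norm_sum_le _ _).trans_eq <| Finset.sum_congr rfl fun j _ => by
        rw [norm_mul, Complex.norm_of_nonneg (hA i j)]
      _ ≤ ∑ j, A i j * (v j * (‖z i‖ / v i)) := Finset.sum_le_sum fun j _ =>
        mul_le_mul_of_nonneg_left ((div_le_iff₀' (hv j)).1 (hi j)) (hA i j)
      _ = l * ‖z i‖ := by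
        simp_rw [← mul_assoc, ← Finset.sum_mul, hvi]
        have := (hv i).ne'
        field_simp
  exact le_of_mul_le_mul_right hle hzi

theorem mem_spectrum_of_pos_eigenvector [Nonempty ι] {A : Matrix ι ι ℝ} {l : ℝ} {v : ι → ℝ}
    (hv : ∀ i, 0 < v i) (h : A.mulVec v = l • v) :
    (l : ℂ) ∈ spectrum ℂ (A.map (algebraMap ℝ ℂ)) := by
  rw [← Matrix.spectrum_toLin', ← Module.End.hasEigenvalue_iff_mem_spectrum]
  refine Module.End.hasEigenvalue_of_hasEigenvector (x := fun i => (v i : ℂ))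
    ⟨Module.End.mem_eigenspace_iff.2 ?_, fun h0 => ?_⟩
  · ext i
    have hvi : ∑ j, A i j * v j = l * v i := congrFun h i
    simpa [Matrix.mulVec, dotProduct] using congrArg (fun r : ℝ => (r : ℂ)) hvi
  · have := congrFun h0 (Classical.arbitrary ι)
    exact (hv _).ne' (by simpa using this)

theorem rho_eq_of_pos_eigenvector [Nonempty ι] {A : Matrix ι ι ℝ} (hA : ∀ i j, 0 ≤ A i j) {l : ℝ}
    {v : ι → ℝ} (hl : 0 ≤ l) (hv : ∀ i, 0 < v i) (h : A.mulVec v = l • v) : rho A = l := by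
  have : spectralRadius ℂ (A.map (algebraMap ℝ ℂ)) = ENNReal.ofReal l := by
    refine le_antisymm (iSup₂_le fun μ hμ => ?_) ?_
    · rw [← enorm_eq_nnnorm, ← ofReal_norm]
      exact ENNReal.ofReal_le_ofReal (norm_le_of_mem_spectrum hA hv h hμ)
    · refine le_trans (le_of_eq ?_) (le_iSup₂ (l : ℂ) (mem_spectrum_of_pos_eigenvector hv h))
      rw [← enorm_eq_nnnorm, ← ofReal_norm, Complex.norm_of_nonneg hl]
  rw [rho, this, ENNReal.toReal_ofReal hl]

/-! ### Convergence and monotonicity -/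

/-- The normalized power method started at `1` converges to a positive multiple of the
Perron vector. -/
theorem tendsto_power_method [Nonempty ι] {A : Matrix ι ι ℝ} (hA : A.IsPrimitive) {l : ℝ}
    {v : ι → ℝ} (hl : 0 < l) (hv : ∀ i, 0 < v i) (h : A.mulVec v = l • v) :
    ∃ c > 0, ∀ i, Tendsto (fun t => (A ^ t).mulVec 1 i / (l ^ t * v i)) atTop (𝓝 c) := by
  obtain ⟨k, -, hpos⟩ := hA.exists_pos_pow
  have hv0 : ∀ i, v i ≠ 0 := fun i => (hv i).ne'
  -- The rescaled sequence starts at `1 / v`; its minimum bounds the limit below, so `c > 0`.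
  obtain ⟨i₀, hi₀⟩ := Finite.exists_min fun i => (v i)⁻¹
  have hstep : ∀ s t i, (A ^ (t + s)).mulVec 1 i / (l ^ (t + s) * v i) =
      ∑ j, (A ^ s) i j * v j / (l ^ s * v i) * ((A ^ t).mulVec 1 j / (l ^ t * v j)) := by
    intro s t i
    rw [add_comm t s, pow_add, ← Matrix.mulVec_mulVec]
    change (∑ j, (A ^ s) i j * (A ^ t).mulVec 1 j) / _ = _
    rw [Finset.sum_div]
    refine Finset.sum_congr rfl fun j _ => ?_
    have := hv0 i
    have := hv0 j
    rw [pow_add]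
    field_simp
  have hsum : ∀ s i, ∑ j, (A ^ s) i j * v j / (l ^ s * v i) = 1 := by
    intro s i
    have hi : ∑ j, (A ^ s) i j * v j = l ^ s * v i := congrFun (pow_mulVec_eigenvector h s) i
    rw [← Finset.sum_div, hi, div_self (mul_ne_zero (pow_ne_zero _ hl.ne') (hv0 i))]
  obtain ⟨c, hc, hlim⟩ := exists_tendsto_const_of_averaging (a := (v i₀)⁻¹)
    (u := fun t i => (A ^ t).mulVec 1 i / (l ^ t * v i))
    (P := fun i j => (A ^ 1) i j * v j / (l ^ 1 * v i))
    (Q := fun i j => (A ^ k) i j * v j / (l ^ k * v i)) (k := k)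
    (fun i j => by
      rw [pow_one]
      exact div_nonneg (mul_nonneg (hA.nonneg i j) (hv j).le) (mul_nonneg (by positivity) (hv i).le))
    (fun i j => div_pos (mul_pos (hpos i j) (hv j)) (mul_pos (pow_pos hl k) (hv i)))
    (hsum 1) (hsum k) (hstep 1) (hstep k) (fun i => by simpa using hi₀ i)
  exact ⟨c, (inv_pos.2 (hv i₀)).trans_le hc, hlim⟩

theorem tendsto_iter [Nonempty ι] {A : Matrix ι ι ℝ} (hA : A.IsPrimitive) {l : ℝ}
    {v : ι → ℝ} (hl : 0 < l) (hv : ∀ i, 0 < v i) (h : A.mulVec v = l • v) :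
    Tendsto (fun t => iter A t) atTop (𝓝 (diagConj v A)) := by
  obtain ⟨c, hc, hlim⟩ := tendsto_power_method hA hl hv h
  refine tendsto_pi_nhds.2 fun i => tendsto_pi_nhds.2 fun j => ?_
  have hlim' := (((hlim j).div (hlim i) hc.ne').const_mul (A i j * v j / v i))
  rw [div_self hc.ne', mul_one] at hlim'
  rw [diagConj_apply fun i => (hv i).ne']
  refine hlim'.congr fun t => ?_
  rw [iter_eq_diagConj hA, diagConj_apply fun i => (pow_mulVec_one_pos hA t i).ne']
  have := pow_mulVec_one_pos hA t i
  have := hv i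
  have := hv j
  simp only [Pi.div_apply]
  field_simp

/-- With `m` the current minimum, `m x_t ≤ x_{t+1}`; applying the nonnegative `A` yields the same
inequality one step later. -/
theorem monotone_minRowSum_iter [Nonempty ι] {A : Matrix ι ι ℝ} (hA : A.IsPrimitive) :
    Monotone fun t => minRowSum (iter A t) := by
  refine monotone_nat_of_le_succ fun t => Finset.le_inf' _ _ fun i _ => ?_
  rw [rowSums_iter hA, le_div_iff₀ (pow_mulVec_one_pos hA (t + 1) i)]
  have hle : minRowSum (iter A t) • (A ^ t).mulVec 1 ≤ (A ^ (t + 1)).mulVec 1 := fun j =>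
    (le_div_iff₀ (pow_mulVec_one_pos hA t j)).1 <|
      (Finset.inf'_le _ (Finset.mem_univ j)).trans_eq (rowSums_iter hA t j)
  have := mulVec_mono hA.nonneg hle i
  rwa [Matrix.mulVec_smul, ← pow_succ_mulVec, ← pow_succ_mulVec] at this

theorem antitone_maxRowSum_iter [Nonempty ι] {A : Matrix ι ι ℝ} (hA : A.IsPrimitive) :
    Antitone fun t => maxRowSum (iter A t) := by
  refine antitone_nat_of_succ_le fun t => Finset.sup'_le _ _ fun i _ => ?_
  rw [rowSums_iter hA, div_le_iff₀ (pow_mulVec_one_pos hA (t + 1) i)]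
  have hle : (A ^ (t + 1)).mulVec 1 ≤ maxRowSum (iter A t) • (A ^ t).mulVec 1 := fun j =>
    (div_le_iff₀ (pow_mulVec_one_pos hA t j)).1 <|
      (rowSums_iter hA t j).symm.trans_le (Finset.le_sup' _ (Finset.mem_univ j))
  have := mulVec_mono hA.nonneg hle i
  rwa [Matrix.mulVec_smul, ← pow_succ_mulVec, ← pow_succ_mulVec] at this

end

end MincIteration

open MincIteration Filter Topology in
theorem theorem2 {ι : Type*} [Fintype ι] [DecidableEq ι] [Nonempty ι]
    (A : Matrix ι ι ℝ) (hA : A.IsPrimitive) :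
    -- the iteration is well defined: all the row sums that are inverted are positive
    (∀ t i, 0 < rowSums (iter A t) i) ∧
    -- the matrices converge, and all row sums of the limit equal the Perron root
    (∃ B : Matrix ι ι ℝ, Tendsto (fun t => iter A t) atTop (𝓝 B) ∧ ∀ i, rowSums B i = rho A) ∧
    -- the bounds on the Perron root, their monotonicity and their convergence
    (∀ t, minRowSum (iter A t) ≤ rho A ∧ rho A ≤ maxRowSum (iter A t)) ∧
    Monotone (fun t => minRowSum (iter A t)) ∧
    Antitone (fun t => maxRowSum (iter A t)) ∧
    Tendsto (fun t => minRowSum (iter A t)) atTop (𝓝 (rho A)) ∧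
    Tendsto (fun t => maxRowSum (iter A t)) atTop (𝓝 (rho A)) ∧
    -- the iterates in terms of the (unnormalized) power method started at the all-ones vector
    (∀ t i, 0 < ((A ^ t).mulVec 1) i) ∧
    (∀ t, iter A t = diagConj ((A ^ t).mulVec 1) A) ∧
    (∀ t i, rowSums (iter A t) i = ((A ^ (t + 1)).mulVec 1) i / ((A ^ t).mulVec 1) i) := by
  obtain ⟨l, v, hl, hv, h⟩ := exists_pos_eigenvector hA
  have hρ : rho A = l := rho_eq_of_pos_eigenvector hA.nonneg hl.le hv h
  have hB := tendsto_iter hA hl hv h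
  have hrow : ∀ i, rowSums (diagConj v A) i = rho A := fun i => by
    rw [rowSums_diagConj fun i => (hv i).ne', h, hρ]
    exact mul_div_cancel_right₀ l (hv i).ne'
  have hr : ∀ i, Tendsto (fun t => rowSums (iter A t) i) atTop (𝓝 (rho A)) := fun i => by
    rw [← hrow i]
    exact tendsto_finsetSum _ fun j _ => tendsto_pi_nhds.1 (tendsto_pi_nhds.1 hB i) j
  have hmin : Tendsto (fun t => minRowSum (iter A t)) atTop (𝓝 (rho A)) := by
    have := Tendsto.finset_inf'_nhds_apply Finset.univ_nonempty fun i (_ : i ∈ Finset.univ) => hr i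
    rwa [Finset.inf'_const] at this
  have hmax : Tendsto (fun t => maxRowSum (iter A t)) atTop (𝓝 (rho A)) := by
    have := Tendsto.finset_sup'_nhds_apply Finset.univ_nonempty fun i (_ : i ∈ Finset.univ) => hr i
    rwa [Finset.sup'_const] at this
  have hmono := monotone_minRowSum_iter hA
  have hanti := antitone_maxRowSum_iter hA
  refine ⟨fun t i => ?_, ⟨_, hB, hrow⟩, fun t => ⟨hmono.ge_of_tendsto hmin t,
    hanti.le_of_tendsto hmax t⟩, hmono, hanti, hmin, hmax, pow_mulVec_one_pos hA,
    iter_eq_diagConj hA, rowSums_iter hA⟩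
  rw [rowSums_iter hA]
  exact div_pos (pow_mulVec_one_pos hA _ i) (pow_mulVec_one_pos hA _ i)
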